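/- Let $0<q<1$ and $\alpha\in\mathbb{R}$. Let $e_n$, $n\in\mathbb{Z}$, be the standard basis of the complex Hilbert space $\ell^2(\mathbb{Z})$, let $U$ be the forward shift, $Ue_n=e_{n+1}$, let $U^*$ be its adjoint, and let $V$ be the self-adjoint diagonal operator $Ve_n=q^{-n}e_n$ on its natural domain $\operatorname{Dom}V=\{\psi\in\ell^2(\mathbb{Z})\mid (q^{-n}\psi_n)_{n\in\mathbb{Z}}\in\ell^2(\mathbb{Z})\}$. Let $B=U+U^*+\alpha V$ be the self-adjoint operator with domain $\operatorname{Dom}V$ if $\alpha\neq 0$, and $B=U+U^*$ with domain $\ell^2(\mathbb{Z})$ if $\alpha=0$. Then $$\operatorname{spec}_{ess}(B)=[-2,2],$$ where $\operatorname{spec}_{ess}(B)$ denotes the set of all accumulation points of the spectrum of $B$ together with all eigenvalues of $B$ of infinite multiplicity. -/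

import Mathlib

open scoped ENNReal

noncomputable section

/-! ### Spectrum and essential spectrum of an unbounded operator -/

section Spectrum

variable {H : Type*} [NormedAddCommGroup H] [InnerProductSpace ℂ H]

/-- The resolvent set of an unbounded operator `T`: the `z : ℂ` for which `T - z : Dom T → H` has
an everywhere defined bounded two-sided inverse `R`. -/
def resolventSetPMap (T : H →ₗ.[ℂ] H) : Set ℂ :=
  {z | ∃ R : H →L[ℂ] H,
    (∀ y : H, ∃ h : R y ∈ T.domain, T ⟨R y, h⟩ - z • R y = y) ∧
    ∀ x : T.domain, R (T x - z • (x : H)) = x}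

/-- The spectrum of an unbounded operator. -/
def spectrumPMap (T : H →ₗ.[ℂ] H) : Set ℂ :=
  (resolventSetPMap T)ᶜ

/-- The eigenspace `Ker (T - z)`, a subspace of `Dom T`. -/
def eigenspacePMap (T : H →ₗ.[ℂ] H) (z : ℂ) : Submodule ℂ T.domain :=
  LinearMap.ker (T.toFun - z • T.domain.subtype)

/-- The essential spectrum of a self-adjoint operator: the accumulation points of the spectrum
together with the eigenvalues of infinite multiplicity. (For a self-adjoint operator the algebraic
and the geometric multiplicity of an eigenvalue coincide.) -/
def essSpectrumPMap (T : H →ₗ.[ℂ] H) : Set ℂ :=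
  {z | AccPt z (Filter.principal (spectrumPMap T)) ∨ ¬ FiniteDimensional ℂ (eigenspacePMap T z)}

end Spectrum

/-! ### The operator `B = U + U* + α V` on `ℓ²(ℤ)` -/

/-- The complex Hilbert space `ℓ²(ℤ)`. -/
abbrev EllTwoZ : Type := lp (fun _ : ℤ => ℂ) 2

theorem memlp_shift (ψ : EllTwoZ) :
    Memℓp (E := fun _ : ℤ => ℂ) (fun n => ψ (n - 1)) 2 := by
  have h := (lp.memℓp ψ).summable (by norm_num)
  exact memℓp_gen ((Equiv.subRight (1 : ℤ)).summable_iff.mpr h)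

/-- The forward shift `U`, `(U ψ) n = ψ (n - 1)`, as an isometry; thus `U e_n = e_{n+1}`. -/
def shiftIsometry : EllTwoZ →ₗᵢ[ℂ] EllTwoZ where
  toFun ψ := ⟨fun n => ψ (n - 1), memlp_shift ψ⟩
  map_add' _ _ := rfl
  map_smul' _ _ := rfl
  norm_map' ψ := by
    rw [lp.norm_eq_tsum_rpow (by norm_num), lp.norm_eq_tsum_rpow (by norm_num)]
    congr 1
    exact (Equiv.subRight (1 : ℤ)).tsum_eq (fun n => ‖ψ n‖ ^ (2 : ℝ≥0∞).toReal)

/-- The forward shift `U` as a bounded operator. -/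
def shiftOp : EllTwoZ →L[ℂ] EllTwoZ := shiftIsometry.toContinuousLinearMap

theorem shiftOp_single (n : ℤ) :
    shiftOp (lp.single 2 n (1 : ℂ)) = lp.single 2 (n + 1) (1 : ℂ) := by
  ext m
  change (lp.single 2 n (1 : ℂ) : EllTwoZ) (m - 1) = _
  simp only [lp.single_apply, Pi.single_apply]
  grind

/-- The diagonal operator `e_n ↦ d n • e_n` on its natural (maximal) domain
`{ψ ∈ ℓ²(ℤ) | (d n ψ n)ₙ ∈ ℓ²(ℤ)}`. -/
def diagOp (d : ℤ → ℝ) : EllTwoZ →ₗ.[ℂ] EllTwoZ where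
  domain :=
    { carrier := {ψ | Memℓp (E := fun _ : ℤ => ℂ) (fun n => (d n : ℂ) * ψ n) 2}
      zero_mem' := by
        change Memℓp (E := fun _ : ℤ => ℂ) (fun n => (d n : ℂ) * (0 : ℂ)) 2
        simpa using (zero_mem_ℓp' : Memℓp (fun _ : ℤ => (0 : ℂ)) 2)
      add_mem' := by
        intro a b ha hb
        have h := Memℓp.add ha hb
        refine (congrArg (fun f => Memℓp (E := fun _ : ℤ => ℂ) f 2) ?_).mpr h
        funext n
        exact mul_add (d n : ℂ) (a n) (b n)
      smul_mem' := by
        intro c a ha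
        have h := Memℓp.const_smul ha c
        refine (congrArg (fun f => Memℓp (E := fun _ : ℤ => ℂ) f 2) ?_).mpr h
        funext n
        exact mul_left_comm (d n : ℂ) c (a n) }
  toFun :=
    { toFun := fun ψ => ⟨fun n => (d n : ℂ) * (ψ : EllTwoZ) n, ψ.2⟩
      map_add' := by
        intro a b
        ext n
        exact mul_add (d n : ℂ) ((a : EllTwoZ) n) ((b : EllTwoZ) n)
      map_smul' := by
        intro c a
        ext n
        exact mul_left_comm (d n : ℂ) c ((a : EllTwoZ) n) }

/-- The operator `V`, `V e_n = q⁻ⁿ e_n`, on its natural domain. -/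
def opV (q : ℝ) : EllTwoZ →ₗ.[ℂ] EllTwoZ := diagOp fun n => q ^ (-n)

/-- The operator `α V`, with `n`-th diagonal entry `α q⁻ⁿ`, on its natural domain. For `α ≠ 0` this
is literally `α • V` on `Dom V` (see `opAlphaV_eq_smul`); for `α = 0` it is the zero operator on
all of `ℓ²(ℤ)`. -/
def opAlphaV (α q : ℝ) : EllTwoZ →ₗ.[ℂ] EllTwoZ := diagOp fun n => α * q ^ (-n)

/-- The operator `B = U + U* + α V`, with `Dom B = Dom (α V)`. -/
def opB (α q : ℝ) : EllTwoZ →ₗ.[ℂ] EllTwoZ :=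
  ((shiftOp + ContinuousLinearMap.adjoint shiftOp : EllTwoZ →L[ℂ] EllTwoZ) :
    EllTwoZ →ₗ[ℂ] EllTwoZ) +ᵥ opAlphaV α q

theorem opAlphaV_eq_smul {α : ℝ} (hα : α ≠ 0) (q : ℝ) :
    opAlphaV α q = (α : ℂ) • opV q := by
  have hα' : (α : ℂ) ≠ 0 := by exact_mod_cast hα
  refine LinearPMap.ext ?_ ?_
  · ext ψ
    constructor
    · intro h
      have h2 := Memℓp.const_smul (show Memℓp (E := fun _ : ℤ => ℂ)
        (fun n => ((α * q ^ (-n) : ℝ) : ℂ) * ψ n) 2 from h) ((α : ℂ)⁻¹)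
      refine (congrArg (fun f => Memℓp (E := fun _ : ℤ => ℂ) f 2) ?_).mpr h2
      funext n
      simp only [Pi.smul_apply, smul_eq_mul]
      push_cast
      field_simp
    · intro h
      have h2 := Memℓp.const_smul (show Memℓp (E := fun _ : ℤ => ℂ)
        (fun n => ((q ^ (-n) : ℝ) : ℂ) * ψ n) 2 from h) (α : ℂ)
      refine (congrArg (fun f => Memℓp (E := fun _ : ℤ => ℂ) f 2) ?_).mpr h2
      funext n
      simp only [Pi.smul_apply, smul_eq_mul]
      push_cast
      ring
  · intro ψ h1 h2
    ext n
    change ((α * q ^ (-n) : ℝ) : ℂ) * ψ n = (α : ℂ) * (((q ^ (-n) : ℝ) : ℂ) * ψ n)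
    push_cast
    ring

end

/-!
Writing `B = U + U* + d`, an estimate `c ‖x‖ ≤ ‖(B - z) x‖ + ‖K x‖` with `K` compact makes bounded
approximate solutions of `(B - z) x = 0` converge along a subsequence. It therefore forces
`Ker (B - z)` to be finite-dimensional and, eigenvectors of a self-adjoint operator at distinct
eigenvalues being orthogonal, keeps the spectrum from accumulating at `z`. For `|z| > 2 ≥ ‖U + U*‖`
such an estimate holds with `K` a multiple of a finite coordinate projection, because
`|d n - z|` stays above some `c > 2` for all but finitely many `n`.

Conversely `d n → 0` as `n → -∞`, so truncated plane waves placed far to the left are approximate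
eigenvectors of `B` at `a + a⁻¹ = 2 cos θ`, `a = exp (iθ)`. Hence `[-2, 2]` lies in the spectrum,
and each of its points is an accumulation point.
-/

open Filter Topology Bornology ComplexConjugate InnerProductSpace

section SelfAdjoint

variable {𝕜 H : Type*} [RCLike 𝕜] [NormedAddCommGroup H] [InnerProductSpace 𝕜 H] [CompleteSpace H]
  {T : H →ₗ.[𝕜] H}

theorem isFormalAdjoint_self_of_isSelfAdjoint (hT : IsSelfAdjoint T) : T.IsFormalAdjoint T := by
  have h := LinearPMap.adjoint_isFormalAdjoint hT.dense_domain
  rwa [LinearPMap.isSelfAdjoint_def.mp hT] at h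

theorem exists_map_eq_of_forall_inner_eq (hT : IsSelfAdjoint T) {y w : H}
    (h : ∀ x : T.domain, ⟪w, (x : H)⟫_𝕜 = ⟪y, T x⟫_𝕜) :
    ∃ hy : y ∈ T.domain, T ⟨y, hy⟩ = w := by
  have hy := LinearPMap.mem_adjoint_domain_of_exists y ⟨w, h⟩
  have hw := LinearPMap.adjoint_apply_eq hT.dense_domain ⟨y, hy⟩ h
  have h' : ∃ hy : y ∈ T.adjoint.domain, T.adjoint ⟨y, hy⟩ = w := ⟨hy, hw⟩
  rwa [LinearPMap.isSelfAdjoint_def.mp hT] at h'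

theorem isSelfAdjoint_of_isFormalAdjoint_self (hdense : Dense (T.domain : Set H))
    (hsymm : T.IsFormalAdjoint T)
    (hmax : ∀ y w : H, (∀ x : T.domain, ⟪w, (x : H)⟫_𝕜 = ⟪y, T x⟫_𝕜) → y ∈ T.domain) :
    IsSelfAdjoint T := by
  refine LinearPMap.isSelfAdjoint_def.mpr
    (LinearPMap.eq_of_le_of_domain_eq (hsymm.le_adjoint hdense) ?_).symm
  refine (hsymm.le_adjoint hdense).1.antisymm fun y hy => hmax y (T.adjoint ⟨y, hy⟩) ?_
  exact LinearPMap.adjoint_isFormalAdjoint hdense ⟨y, hy⟩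

theorem isSelfAdjoint_vadd {A : H →L[𝕜] H} (hA : IsSelfAdjoint A) (hT : IsSelfAdjoint T) :
    IsSelfAdjoint ((A : H →ₗ[𝕜] H) +ᵥ T) := by
  have hAsymm : ∀ x y : H, ⟪A x, y⟫_𝕜 = ⟪x, A y⟫_𝕜 := hA.isSymmetric
  refine isSelfAdjoint_of_isFormalAdjoint_self hT.dense_domain (fun x y => ?_) fun y w h => ?_
  · simp only [LinearPMap.vadd_apply, ContinuousLinearMap.coe_coe, inner_add_left, inner_add_right]
    rw [hAsymm, isFormalAdjoint_self_of_isSelfAdjoint hT x y]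
  · obtain ⟨hy, -⟩ := exists_map_eq_of_forall_inner_eq hT (y := y) (w := w - A y) fun x => by
      rw [inner_sub_left, h x, LinearPMap.vadd_apply, inner_add_right, hAsymm]
      exact add_sub_cancel_left _ _
    exact hy

end SelfAdjoint

section BoundedBelowModCompact

variable {𝕜 E F : Type*} [NontriviallyNormedField 𝕜] [NormedAddCommGroup E] [NormedSpace 𝕜 E]
  [NormedAddCommGroup F] [NormedSpace 𝕜 F] {T : E →ₗ.[𝕜] E} {z : 𝕜}

/-- The upper semi-Fredholm estimate `c ‖x‖ ≤ ‖(T - z) x‖ + ‖K x‖` with `c > 0` and `K` compact.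
For closed `T` it makes bounded approximate solutions of `(T - z) x = y` converge along a
subsequence. -/
def BoundedBelowModCompact (T : E →ₗ.[𝕜] E) (z : 𝕜) : Prop :=
  ∃ c > 0, ∃ K : E →L[𝕜] E, IsCompactOperator K ∧
    ∀ x : T.domain, c * ‖(x : E)‖ ≤ ‖T x - z • (x : E)‖ + ‖K x‖

variable [CompleteSpace E]

theorem exists_tendsto_of_bounded_below (hT : T.IsClosed) {c : ℝ} (hc : 0 < c) {K : E →L[𝕜] F}
    (hbelow : ∀ x : T.domain, c * ‖(x : E)‖ ≤ ‖T x - z • (x : E)‖ + ‖K x‖)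
    {u : ℕ → T.domain} {y : E} (hu : Tendsto (fun k => T (u k) - z • (u k : E)) atTop (𝓝 y))
    (hK : CauchySeq fun k => K (u k)) :
    ∃ x : T.domain, Tendsto (fun k => (u k : E)) atTop (𝓝 (x : E)) ∧ T x - z • (x : E) = y := by
  have hcauchy : CauchySeq fun k => (u k : E) := by
    have hsum := (cauchySeq_iff_tendsto_dist_atTop_0.mp hu.cauchySeq).add
      (cauchySeq_iff_tendsto_dist_atTop_0.mp hK)
    have hbound : ∀ k l, c * dist (u k : E) (u l) ≤
        dist (T (u k) - z • (u k : E)) (T (u l) - z • (u l : E)) + dist (K (u k)) (K (u l)) := by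
      intro k l
      have h := hbelow (u k - u l)
      rwa [Submodule.coe_sub, LinearPMap.map_sub, smul_sub, sub_sub_sub_comm, map_sub,
        ← dist_eq_norm, ← dist_eq_norm, ← dist_eq_norm] at h
    refine cauchySeq_iff_tendsto_dist_atTop_0.mpr <| squeeze_zero (fun _ => dist_nonneg)
      (fun p => (le_inv_mul_iff₀ hc).mpr (hbound p.1 p.2)) ?_
    simpa using hsum.const_mul c⁻¹
  obtain ⟨x, hx⟩ := cauchySeq_tendsto_of_complete hcauchy
  have hTu : Tendsto (fun k => T (u k)) atTop (𝓝 (y + z • x)) := by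
    simpa using hu.add (hx.const_smul z)
  obtain ⟨x', rfl, hx'⟩ := (LinearPMap.mem_graph_iff T).mp <| hT.mem_of_tendsto
    (hx.prodMk_nhds hTu) (Eventually.of_forall fun k => T.mem_graph (u k))
  exact ⟨x', hx, by rw [hx']; exact add_sub_cancel_right _ _⟩

theorem BoundedBelowModCompact.exists_subseq_tendsto (hz : BoundedBelowModCompact T z)
    (hT : T.IsClosed) {u : ℕ → T.domain} {r : ℝ} (hbdd : ∀ k, ‖(u k : E)‖ ≤ r) {y : E}
    (hu : Tendsto (fun k => T (u k) - z • (u k : E)) atTop (𝓝 y)) :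
    ∃ x : T.domain, ∃ φ : ℕ → ℕ, StrictMono φ ∧
      Tendsto (fun k => (u (φ k) : E)) atTop (𝓝 (x : E)) ∧ T x - z • (x : E) = y := by
  obtain ⟨c, hc, K, hK, hbelow⟩ := hz
  have hmem : ∀ k, K (u k) ∈ closure (K '' Metric.closedBall 0 r) := fun k =>
    subset_closure ⟨u k, mem_closedBall_zero_iff.mpr (hbdd k), rfl⟩
  obtain ⟨_, -, φ, hφ, hlim⟩ := (hK.isCompact_closure_image_closedBall r).tendsto_subseq hmem
  obtain ⟨x, hx, hTx⟩ := exists_tendsto_of_bounded_below hT hc hbelow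
    (hu.comp hφ.tendsto_atTop) hlim.cauchySeq
  exact ⟨x, φ, hφ, hx, hTx⟩

end BoundedBelowModCompact

section Resolvent

variable {H : Type*} [NormedAddCommGroup H] [InnerProductSpace ℂ H] {T : H →ₗ.[ℂ] H} {z : ℂ}

theorem exists_bounded_below_of_mem_resolventSetPMap (hz : z ∈ resolventSetPMap T) :
    ∃ c > 0, ∀ x : T.domain, c * ‖(x : H)‖ ≤ ‖T x - z • (x : H)‖ := by
  obtain ⟨R, -, hR⟩ := hz
  refine ⟨(‖R‖ + 1)⁻¹, by positivity, fun x => ?_⟩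
  rw [inv_mul_le_iff₀ (by positivity)]
  calc ‖(x : H)‖ = ‖R (T x - z • (x : H))‖ := by rw [hR]
    _ ≤ ‖R‖ * ‖T x - z • (x : H)‖ := R.le_opNorm _
    _ ≤ (‖R‖ + 1) * ‖T x - z • (x : H)‖ := by gcongr; linarith

theorem mem_resolventSetPMap_of_bounded_below_of_surjective {c : ℝ} (hc : 0 < c)
    (hbelow : ∀ x : T.domain, c * ‖(x : H)‖ ≤ ‖T x - z • (x : H)‖)
    (hsurj : ∀ y : H, ∃ x : T.domain, T x - z • (x : H) = y) : z ∈ resolventSetPMap T := by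
  let S : T.domain →ₗ[ℂ] H := T.toFun - z • T.domain.subtype
  have hinj : Function.Injective S := (injective_iff_map_eq_zero S).mpr fun x hx => by
    have hx' : T x - z • (x : H) = 0 := hx
    have h := hbelow x
    rw [hx', norm_zero] at h
    exact Subtype.ext (norm_le_zero_iff.mp (nonpos_of_mul_nonpos_right h hc))
  let e := LinearEquiv.ofBijective S ⟨hinj, hsurj⟩
  have hright : ∀ y, T (e.symm y) - z • (e.symm y : H) = y := e.apply_symm_apply
  refine ⟨(T.domain.subtype ∘ₗ e.symm.toLinearMap).mkContinuous c⁻¹ fun y => ?_,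
    fun y => ⟨(e.symm y).2, hright y⟩, fun x => congrArg Subtype.val (e.symm_apply_apply x)⟩
  rw [le_inv_mul_iff₀ hc]
  have h := hbelow (e.symm y)
  rwa [hright] at h

theorem norm_sub_smul_sq_of_isFormalAdjoint_self (hT : T.IsFormalAdjoint T) (z : ℂ) (x : T.domain) :
    ‖T x - z • (x : H)‖ ^ 2 = ‖T x - (z.re : ℂ) • (x : H)‖ ^ 2 + (z.im * ‖(x : H)‖) ^ 2 := by
  have hreal : (⟪T x, (x : H)⟫_ℂ).im = 0 := by
    rw [← Complex.conj_eq_iff_im, inner_conj_symm, hT x x]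
  have hre : ∀ w : ℂ, RCLike.re ⟪T x, w • (x : H)⟫_ℂ = w.re * (⟪T x, (x : H)⟫_ℂ).re := fun w => by
    simp [hreal]
  rw [@norm_sub_sq ℂ, @norm_sub_sq ℂ, hre, hre, norm_smul, norm_smul, mul_pow, mul_pow,
    Complex.sq_norm z, Complex.normSq_apply]
  simp only [Complex.ofReal_re, Complex.norm_real, Real.norm_eq_abs, sq_abs]
  ring

theorem norm_sub_conj_smul_of_isFormalAdjoint_self (hT : T.IsFormalAdjoint T) (z : ℂ)
    (x : T.domain) : ‖T x - conj z • (x : H)‖ = ‖T x - z • (x : H)‖ := by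
  rw [← sq_eq_sq₀ (norm_nonneg _) (norm_nonneg _), norm_sub_smul_sq_of_isFormalAdjoint_self hT,
    norm_sub_smul_sq_of_isFormalAdjoint_self hT z]
  simp

theorem abs_im_mul_norm_le_of_isFormalAdjoint_self (hT : T.IsFormalAdjoint T) (z : ℂ)
    (x : T.domain) : |z.im| * ‖(x : H)‖ ≤ ‖T x - z • (x : H)‖ := by
  rw [← abs_norm (x : H), ← abs_mul]
  refine abs_le_of_sq_le_sq ?_ (norm_nonneg _)
  rw [norm_sub_smul_sq_of_isFormalAdjoint_self hT]
  exact le_add_of_nonneg_left (sq_nonneg _)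

theorem norm_sub_mul_norm_inner_le (hT : T.IsFormalAdjoint T) {w : ℂ} (hw : w.im = 0)
    {x : T.domain} (hx : T x = z • (x : H)) (u : T.domain) :
    ‖w - z‖ * ‖⟪(x : H), (u : H)⟫_ℂ‖ ≤ ‖(x : H)‖ * ‖T u - w • (u : H)‖ := by
  have h : ⟪(x : H), T u - w • (u : H)⟫_ℂ = conj (z - w) * ⟪(x : H), (u : H)⟫_ℂ := by
    rw [inner_sub_right, inner_smul_right, ← hT x u, hx, inner_smul_left, map_sub,
      Complex.conj_eq_iff_im.mpr hw]
    ring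
  rw [norm_sub_rev, ← Complex.norm_conj, ← norm_mul, ← h]
  exact norm_inner_le_norm _ _

section BoundedBelow

variable [CompleteSpace H]

theorem exists_map_sub_smul_eq_of_bounded_below (hT : IsSelfAdjoint T) {c : ℝ} (hc : 0 < c)
    (hbelow : ∀ x : T.domain, c * ‖(x : H)‖ ≤ ‖T x - z • (x : H)‖) (y : H) :
    ∃ x : T.domain, T x - z • (x : H) = y := by
  let S : T.domain →ₗ[ℂ] H := T.toFun - z • T.domain.subtype
  have hS : ∀ x, S x = T x - z • (x : H) := fun _ => rfl
  have hclosed : IsClosed (S.range : Set H) := by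
    refine isClosed_of_closure_subset fun w hw => ?_
    obtain ⟨v, hv, hvw⟩ := mem_closure_iff_seq_limit.mp hw
    choose u hu using hv
    obtain ⟨x, -, hx⟩ := exists_tendsto_of_bounded_below (K := (0 : H →L[ℂ] H)) hT.isClosed hc
      (by simpa using hbelow) (u := u) (by simpa only [← hS, hu] using hvw)
      (by simpa using cauchySeq_const 0)
    exact ⟨x, hx⟩
  have horth : S.rangeᗮ = ⊥ := (Submodule.eq_bot_iff _).mpr fun v hv => by
    have hinner : ∀ x : T.domain, ⟪conj z • v, (x : H)⟫_ℂ = ⟪v, T x⟫_ℂ := fun x => by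
      have h : ⟪v, S x⟫_ℂ = 0 := Submodule.inner_left_of_mem_orthogonal (S.mem_range_self x) hv
      rw [hS, inner_sub_right, inner_smul_right, sub_eq_zero] at h
      rw [inner_smul_left, Complex.conj_conj, h]
    obtain ⟨hvT, hTv⟩ := exists_map_eq_of_forall_inner_eq hT hinner
    have h := hbelow ⟨v, hvT⟩
    rw [← norm_sub_conj_smul_of_isFormalAdjoint_self (isFormalAdjoint_self_of_isSelfAdjoint hT),
      hTv, sub_self, norm_zero] at h
    exact norm_le_zero_iff.mp (nonpos_of_mul_nonpos_right h hc)
  have : CompleteSpace S.range := hclosed.completeSpace_coe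
  have htop : y ∈ S.range := by rw [Submodule.orthogonal_eq_bot_iff.mp horth]; trivial
  exact htop

theorem mem_resolventSetPMap_iff (hT : IsSelfAdjoint T) : z ∈ resolventSetPMap T ↔
    ∃ c > 0, ∀ x : T.domain, c * ‖(x : H)‖ ≤ ‖T x - z • (x : H)‖ :=
  ⟨exists_bounded_below_of_mem_resolventSetPMap, fun ⟨_, hc, hbelow⟩ =>
    mem_resolventSetPMap_of_bounded_below_of_surjective hc hbelow
      (exists_map_sub_smul_eq_of_bounded_below hT hc hbelow)⟩

theorem mem_spectrumPMap_iff (hT : IsSelfAdjoint T) : z ∈ spectrumPMap T ↔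
    ∀ ε > 0, ∃ x : T.domain, ‖T x - z • (x : H)‖ < ε * ‖(x : H)‖ := by
  rw [spectrumPMap, Set.mem_compl_iff, mem_resolventSetPMap_iff hT]
  simp only [gt_iff_lt, not_exists, not_and, not_forall, not_le]

theorem exists_norm_eq_one_of_mem_spectrumPMap (hT : IsSelfAdjoint T) (hz : z ∈ spectrumPMap T)
    {ε : ℝ} (hε : 0 < ε) : ∃ x : T.domain, ‖(x : H)‖ = 1 ∧ ‖T x - z • (x : H)‖ < ε := by
  obtain ⟨x, hx⟩ := (mem_spectrumPMap_iff hT).mp hz ε hε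
  have hx0 : 0 < ‖(x : H)‖ := pos_of_mul_pos_right ((norm_nonneg _).trans_lt hx) hε.le
  have hnorm : ‖((‖(x : H)‖⁻¹ : ℝ) : ℂ)‖ = ‖(x : H)‖⁻¹ := by simp
  refine ⟨((‖(x : H)‖⁻¹ : ℝ) : ℂ) • x, ?_, ?_⟩
  · rw [Submodule.coe_smul, norm_smul, hnorm, inv_mul_cancel₀ hx0.ne']
  · rw [LinearPMap.map_smul, Submodule.coe_smul, smul_comm z, ← smul_sub, norm_smul, hnorm,
      inv_mul_lt_iff₀ hx0, mul_comm]
    exact hx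

theorem im_eq_zero_of_mem_spectrumPMap (hT : IsSelfAdjoint T) (hz : z ∈ spectrumPMap T) :
    z.im = 0 := by
  by_contra him
  exact hz <| (mem_resolventSetPMap_iff hT).mpr ⟨|z.im|, abs_pos.mpr him,
    abs_im_mul_norm_le_of_isFormalAdjoint_self (isFormalAdjoint_self_of_isSelfAdjoint hT) z⟩

end BoundedBelow

end Resolvent

section EssentialSpectrum

variable {H : Type*} [NormedAddCommGroup H] [InnerProductSpace ℂ H] {T : H →ₗ.[ℂ] H} {z : ℂ}

theorem boundedBelowModCompact_of_im_ne_zero (hT : T.IsFormalAdjoint T) (hz : z.im ≠ 0) :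
    BoundedBelowModCompact T z :=
  ⟨|z.im|, abs_pos.mpr hz, 0, isCompactOperator_zero, fun x => by
    simpa using abs_im_mul_norm_le_of_isFormalAdjoint_self hT z x⟩

theorem subset_essSpectrumPMap_of_preperfect {S : Set ℂ} (hS : Preperfect S)
    (hST : S ⊆ spectrumPMap T) : S ⊆ essSpectrumPMap T :=
  fun z hz => Or.inl ((hS z hz).mono (principal_mono.mpr hST))

variable [CompleteSpace H]

theorem BoundedBelowModCompact.finiteDimensional_eigenspacePMap (hz : BoundedBelowModCompact T z)
    (hT : T.IsClosed) : FiniteDimensional ℂ (eigenspacePMap T z) := by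
  have hmem : ∀ x : T.domain, x ∈ eigenspacePMap T z ↔ T x - z • (x : H) = 0 := fun _ => Iff.rfl
  refine FiniteDimensional.of_isCompact_closedBall₀ ℂ one_pos (IsSeqCompact.isCompact ?_)
  intro u hu
  have hbdd : ∀ k, ‖((u k : T.domain) : H)‖ ≤ 1 := fun k => mem_closedBall_zero_iff.mp (hu k)
  obtain ⟨x, φ, hφ, hx, hTx⟩ := hz.exists_subseq_tendsto hT hbdd (y := 0)
    (by simp only [(hmem _).mp (u _).2, tendsto_const_nhds])
  refine ⟨⟨x, hTx⟩, ?_, φ, hφ, ?_⟩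
  · exact mem_closedBall_zero_iff.mpr (le_of_tendsto hx.norm (Eventually.of_forall fun k => hbdd _))
  · exact tendsto_subtype_rng.mpr (tendsto_subtype_rng.mpr hx)

theorem BoundedBelowModCompact.not_accPt_spectrumPMap (hz : BoundedBelowModCompact T z)
    (hT : IsSelfAdjoint T) : ¬ AccPt z (𝓟 (spectrumPMap T)) := by
  intro hacc
  rw [accPt_principal_iff_clusterPt, ← mem_closure_iff_clusterPt] at hacc
  obtain ⟨w, hw, hwz⟩ := mem_closure_iff_seq_limit.mp hacc
  have hdist : Tendsto (fun k => ‖w k - z‖) atTop (𝓝 0) := tendsto_iff_norm_sub_tendsto_zero.mp hwz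
  have hpos : ∀ k, 0 < ‖w k - z‖ := fun k => norm_sub_pos_iff.mpr (hw k).2
  choose u hu_norm hu using fun k =>
    exists_norm_eq_one_of_mem_spectrumPMap hT (hw k).1 (pow_pos (hpos k) 2)
  have hlim : Tendsto (fun k => T (u k) - z • (u k : H)) atTop (𝓝 0) := by
    refine squeeze_zero_norm (fun k => ?_) (by simpa using (hdist.pow 2).add hdist)
    calc ‖T (u k) - z • (u k : H)‖
        = ‖(T (u k) - w k • (u k : H)) + (w k - z) • (u k : H)‖ := by congr 1; module
      _ ≤ ‖T (u k) - w k • (u k : H)‖ + ‖(w k - z) • (u k : H)‖ := norm_add_le _ _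
      _ ≤ ‖w k - z‖ ^ 2 + ‖w k - z‖ := by
        rw [norm_smul, hu_norm, mul_one]
        gcongr
        exact (hu k).le
  obtain ⟨x, φ, hφ, hx, hTx⟩ :=
    hz.exists_subseq_tendsto hT.isClosed (fun k => (hu_norm k).le) hlim
  have hx_norm : ‖(x : H)‖ = 1 :=
    tendsto_nhds_unique hx.norm (by simp only [hu_norm, tendsto_const_nhds])
  -- The limit `x` is an eigenvector at `z`, hence almost orthogonal to the `u k`.
  have hinner : ∀ k, ‖⟪(x : H), (u k : H)⟫_ℂ‖ ≤ ‖w k - z‖ := fun k => by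
    have h := norm_sub_mul_norm_inner_le (isFormalAdjoint_self_of_isSelfAdjoint hT)
      (im_eq_zero_of_mem_spectrumPMap hT (hw k).1) (sub_eq_zero.mp hTx) (u k)
    rw [hx_norm, one_mul] at h
    exact le_of_mul_le_mul_left (h.trans ((hu k).le.trans_eq (sq _))) (hpos k)
  have hinner_lim := squeeze_zero_norm (fun k => hinner (φ k)) (hdist.comp hφ.tendsto_atTop)
  have h := tendsto_nhds_unique hinner_lim (tendsto_const_nhds.inner hx)
  rw [inner_self_eq_norm_sq_to_K, hx_norm] at h
  norm_num at h

theorem BoundedBelowModCompact.notMem_essSpectrumPMap (hz : BoundedBelowModCompact T z)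
    (hT : IsSelfAdjoint T) : z ∉ essSpectrumPMap T := fun h =>
  h.elim (hz.not_accPt_spectrumPMap hT) fun hinf =>
    hinf (hz.finiteDimensional_eigenspacePMap hT.isClosed)

end EssentialSpectrum

section DiagonalOperator

variable {d : ℤ → ℝ}

theorem mem_diagOp_domain {ψ : EllTwoZ} : ψ ∈ (diagOp d).domain ↔
    Memℓp (E := fun _ : ℤ => ℂ) (fun n => (d n : ℂ) * ψ n) 2 := Iff.rfl

theorem diagOp_apply (ψ : (diagOp d).domain) (n : ℤ) :
    diagOp d ψ n = d n * (ψ : EllTwoZ) n := rfl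

theorem single_mem_diagOp_domain (n : ℤ) (a : ℂ) :
    (lp.single 2 n a : EllTwoZ) ∈ (diagOp d).domain := by
  have h : (fun m => (d m : ℂ) * (lp.single 2 n a : EllTwoZ) m) =
      (lp.single 2 n ((d n : ℂ) * a) : EllTwoZ) := by
    ext m
    by_cases hm : m = n <;> simp [lp.single_apply, hm]
  rw [mem_diagOp_domain, h]
  exact lp.memℓp _

theorem diagOp_single (n : ℤ) (a : ℂ) :
    diagOp d ⟨lp.single 2 n a, single_mem_diagOp_domain n a⟩ = lp.single 2 n (d n * a) := by
  ext m
  rw [diagOp_apply]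
  by_cases hm : m = n <;> simp [lp.single_apply, hm]

theorem dense_diagOp_domain : Dense ((diagOp d).domain : Set EllTwoZ) := fun ψ =>
  mem_closure_of_tendsto (lp.hasSum_single ENNReal.ofNat_ne_top ψ)
    (Eventually.of_forall fun _ => Submodule.sum_mem _ fun n _ => single_mem_diagOp_domain n (ψ n))

theorem isFormalAdjoint_self_diagOp : (diagOp d).IsFormalAdjoint (diagOp d) := fun φ ψ => by
  rw [lp.inner_eq_tsum, lp.inner_eq_tsum]
  refine tsum_congr fun n => ?_
  simp only [diagOp_apply, RCLike.inner_apply, map_mul, Complex.conj_ofReal]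
  ring

theorem isSelfAdjoint_diagOp : IsSelfAdjoint (diagOp d) := by
  refine isSelfAdjoint_of_isFormalAdjoint_self dense_diagOp_domain isFormalAdjoint_self_diagOp
    fun ψ φ h => ?_
  have hφ : (fun n => (d n : ℂ) * ψ n) = φ := by
    ext n
    have hn := h ⟨lp.single 2 n 1, single_mem_diagOp_domain n 1⟩
    rw [diagOp_single, lp.inner_single_right, lp.inner_single_right] at hn
    simpa using (congrArg conj hn).symm
  rw [mem_diagOp_domain, hφ]
  exact lp.memℓp φ

theorem norm_diagOp_le {δ : ℝ} {ψ : (diagOp d).domain}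
    (h : ∀ n, (ψ : EllTwoZ) n ≠ 0 → |d n| ≤ δ) (hδ : 0 ≤ δ) :
    ‖diagOp d ψ‖ ≤ δ * ‖(ψ : EllTwoZ)‖ := by
  have hmono : ‖diagOp d ψ‖ ≤ ‖(δ : ℂ) • (ψ : EllTwoZ)‖ := by
    refine lp.norm_mono two_ne_zero fun n => ?_
    rw [diagOp_apply, lp.coeFn_smul, Pi.smul_apply, norm_mul, norm_smul, Complex.norm_real,
      Complex.norm_of_nonneg hδ, Real.norm_eq_abs]
    rcases eq_or_ne ((ψ : EllTwoZ) n) 0 with hn | hn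
    · simp only [hn, norm_zero, mul_zero, le_refl]
    · exact mul_le_mul_of_nonneg_right (h n hn) (norm_nonneg _)
  rwa [norm_smul, Complex.norm_of_nonneg hδ] at hmono

/-- The orthogonal projection of `ℓ²(ℤ)` onto the span of the `e_n`, `n ∈ F`. -/
noncomputable def coordProj (F : Finset ℤ) : EllTwoZ →L[ℂ] EllTwoZ :=
  ∑ n ∈ F, lp.singleContinuousLinearMap ℂ (fun _ : ℤ => ℂ) 2 n ∘L
    lp.evalCLM ℂ (fun _ : ℤ => ℂ) 2 n

theorem coordProj_apply (F : Finset ℤ) (ψ : EllTwoZ) (n : ℤ) :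
    coordProj F ψ n = if n ∈ F then ψ n else 0 := by
  have h : coordProj F ψ = ∑ m ∈ F, (lp.single 2 m (ψ m) : EllTwoZ) := by
    rw [coordProj, sum_apply]
    rfl
  rw [h, lp.coeFn_sum, Finset.sum_apply]
  simp [lp.single_apply, Pi.single_apply]

theorem isCompactOperator_coordProj (F : Finset ℤ) : IsCompactOperator (coordProj F) := by
  refine Submodule.sum_mem (compactOperator (RingHom.id ℂ) EllTwoZ EllTwoZ) fun n _ => ?_
  have h : IsCompactOperator (lp.singleContinuousLinearMap ℂ (fun _ : ℤ => ℂ) 2 n) :=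
    isCompactOperator_of_locallyCompactSpace_rng (M₂ := ℂ) _
  exact h.comp_clm (lp.evalCLM ℂ (fun _ : ℤ => ℂ) 2 n)

theorem mul_norm_sub_coordProj_le {z : ℂ} {c : ℝ} (hc : 0 ≤ c) {F : Finset ℤ}
    (hF : ∀ n ∉ F, c ≤ ‖(d n : ℂ) - z‖) (ψ : (diagOp d).domain) :
    c * ‖(ψ : EllTwoZ) - coordProj F ψ‖ ≤ ‖diagOp d ψ - z • (ψ : EllTwoZ)‖ := by
  rw [← Complex.norm_of_nonneg hc, ← norm_smul]
  refine lp.norm_mono two_ne_zero fun n => ?_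
  simp only [lp.coeFn_smul, lp.coeFn_sub, Pi.smul_apply, Pi.sub_apply, diagOp_apply, smul_eq_mul,
    coordProj_apply, ← sub_mul, norm_mul, Complex.norm_of_nonneg hc]
  split_ifs with hn
  · rw [sub_self, norm_zero, mul_zero]
    positivity
  · rw [sub_zero]
    exact mul_le_mul_of_nonneg_right (hF n hn) (norm_nonneg _)

theorem boundedBelowModCompact_vadd_diagOp {A : EllTwoZ →L[ℂ] EllTwoZ} {z : ℂ} {c : ℝ}
    (hA : ‖A‖ < c) (hd : ∀ᶠ n in cofinite, c ≤ ‖(d n : ℂ) - z‖) :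
    BoundedBelowModCompact ((A : EllTwoZ →ₗ[ℂ] EllTwoZ) +ᵥ diagOp d) z := by
  have hc : 0 < c := (norm_nonneg A).trans_lt hA
  let F := (eventually_cofinite.mp hd).toFinset
  have hF : ∀ n ∉ F, c ≤ ‖(d n : ℂ) - z‖ := fun n hn => by simpa [F] using hn
  refine ⟨c - ‖A‖, sub_pos.mpr hA, (c : ℂ) • coordProj F,
    (isCompactOperator_coordProj F).smul (c : ℂ), fun (ψ : (diagOp d).domain) => ?_⟩
  set x : EllTwoZ := ψ.1
  have hsplit : c * ‖x‖ ≤ c * ‖x - coordProj F x‖ + c * ‖coordProj F x‖ := by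
    rw [← mul_add]
    exact mul_le_mul_of_nonneg_left (norm_le_norm_sub_add _ _) hc.le
  have hoff : c * ‖x - coordProj F x‖ ≤ ‖A x + diagOp d ψ - z • x‖ + ‖A‖ * ‖x‖ := calc
    c * ‖x - coordProj F x‖ ≤ ‖diagOp d ψ - z • x‖ := mul_norm_sub_coordProj_le hc.le hF ψ
    _ = ‖A x + diagOp d ψ - z • x - A x‖ := by congr 1; abel
    _ ≤ ‖A x + diagOp d ψ - z • x‖ + ‖A x‖ := norm_sub_le _ _
    _ ≤ ‖A x + diagOp d ψ - z • x‖ + ‖A‖ * ‖x‖ := by gcongr; exact A.le_opNorm x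
  change (c - ‖A‖) * ‖x‖ ≤ ‖A x + diagOp d ψ - z • x‖ + ‖(c : ℂ) • coordProj F x‖
  rw [norm_smul, Complex.norm_of_nonneg hc.le]
  linarith

end DiagonalOperator

theorem norm_add_adjoint_sub_le {H : Type*} [NormedAddCommGroup H] [InnerProductSpace ℂ H]
    [CompleteSpace H] {V : H →L[ℂ] H} (hV : ∀ x, ‖V x‖ = ‖x‖) {a : ℂ} (ha : ‖a‖ = 1) (x : H) :
    ‖(V + ContinuousLinearMap.adjoint V) x - (a + a⁻¹) • x‖ ≤ 2 * ‖V x - a • x‖ := by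
  have ha0 : a ≠ 0 := norm_ne_zero_iff.mp (ha.trans_ne one_ne_zero)
  have hV' : ContinuousLinearMap.adjoint V (V x) = x :=
    congrArg (· x) ((ContinuousLinearMap.norm_map_iff_adjoint_comp_self V).mp hV)
  have hnorm : ‖ContinuousLinearMap.adjoint V‖ ≤ 1 := by
    rw [LinearIsometryEquiv.norm_map]
    exact V.opNorm_le_bound zero_le_one fun x => by rw [hV, one_mul]
  have hsplit : (V + ContinuousLinearMap.adjoint V) x - (a + a⁻¹) • x =
      (V x - a • x) - a⁻¹ • ContinuousLinearMap.adjoint V (V x - a • x) := by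
    rw [map_sub, map_smul, hV', smul_sub, inv_smul_smul₀ ha0, add_apply]
    module
  rw [hsplit, two_mul]
  refine (norm_sub_le _ _).trans (add_le_add_right ?_ _)
  rw [norm_smul, norm_inv, ha, inv_one, one_mul]
  exact ContinuousLinearMap.le_of_opNorm_le_of_le _ hnorm le_rfl |>.trans_eq (one_mul _)

section JacobiOperator

variable {d : ℤ → ℝ}

/-- The hopping operator `U + U*`, the free Jacobi operator `ψ ↦ (ψ (n - 1) + ψ (n + 1))ₙ`. -/
noncomputable def hopOp : EllTwoZ →L[ℂ] EllTwoZ := shiftOp + ContinuousLinearMap.adjoint shiftOp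

/-- The Jacobi operator `U + U* + d` with diagonal `d`, on the maximal domain of the diagonal. -/
noncomputable def jacobiOp (d : ℤ → ℝ) : EllTwoZ →ₗ.[ℂ] EllTwoZ :=
  (hopOp : EllTwoZ →ₗ[ℂ] EllTwoZ) +ᵥ diagOp d

theorem opB_eq_jacobiOp (α q : ℝ) : opB α q = jacobiOp fun n => α * q ^ (-n) := rfl

theorem isSelfAdjoint_hopOp : IsSelfAdjoint hopOp := IsSelfAdjoint.add_star_self shiftOp

theorem norm_shiftOp_apply (ψ : EllTwoZ) : ‖shiftOp ψ‖ = ‖ψ‖ := shiftIsometry.norm_map ψ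

theorem norm_hopOp_le : ‖hopOp‖ ≤ 2 := by
  have h : ‖shiftOp‖ ≤ 1 := shiftIsometry.norm_toContinuousLinearMap_le
  calc ‖hopOp‖ ≤ ‖shiftOp‖ + ‖ContinuousLinearMap.adjoint shiftOp‖ := norm_add_le _ _
    _ ≤ 1 + 1 := by rw [LinearIsometryEquiv.norm_map]; gcongr
    _ = 2 := one_add_one_eq_two

theorem isSelfAdjoint_jacobiOp : IsSelfAdjoint (jacobiOp d) :=
  isSelfAdjoint_vadd isSelfAdjoint_hopOp isSelfAdjoint_diagOp

/-- The plane wave `∑ₖ aᵏ e_{m-k}`, `0 ≤ k < N`, truncated to the sites `m - N < n ≤ m`. For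
`‖a‖ = 1` and large `N` it is an approximate eigenvector of the shift with eigenvalue `a`. -/
noncomputable def planeWave (a : ℂ) (m : ℤ) (N : ℕ) : EllTwoZ :=
  ∑ k ∈ Finset.range N, a ^ k • lp.single 2 (m - k) (1 : ℂ)

theorem planeWave_mem_diagOp_domain (a : ℂ) (m : ℤ) (N : ℕ) :
    planeWave a m N ∈ (diagOp d).domain :=
  Submodule.sum_mem _ fun _ _ => Submodule.smul_mem _ _ (single_mem_diagOp_domain _ _)

theorem le_of_planeWave_apply_ne_zero {a : ℂ} {m : ℤ} {N : ℕ} {n : ℤ}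
    (hn : planeWave a m N n ≠ 0) : n ≤ m := by
  contrapose! hn
  rw [planeWave, lp.coeFn_sum, Finset.sum_apply]
  refine Finset.sum_eq_zero fun k _ => ?_
  rw [lp.coeFn_smul, Pi.smul_apply, lp.single_apply_ne 2 _ _ (by omega), smul_zero]

theorem norm_planeWave_sq {a : ℂ} (ha : ‖a‖ = 1) (m : ℤ) (N : ℕ) : ‖planeWave a m N‖ ^ 2 = N := by
  let e : ℕ ↪ ℤ := ⟨fun k => m - k, fun i j h => by simpa using h⟩
  have hsum : planeWave a m N =
      ∑ n ∈ (Finset.range N).map e, lp.single 2 n (a ^ (m - n)) := by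
    rw [Finset.sum_map]
    refine Finset.sum_congr rfl fun k _ => ?_
    change _ = lp.single (E := fun _ : ℤ => ℂ) 2 (m - (k : ℤ)) (a ^ (m - (m - (k : ℤ))))
    rw [← lp.single_smul, smul_eq_mul, mul_one, sub_sub_cancel, zpow_natCast]
  have hnorm := lp.norm_sum_single (E := fun _ : ℤ => ℂ) (p := 2) (by norm_num)
    (fun n => a ^ (m - n)) ((Finset.range N).map e)
  rw [← hsum] at hnorm
  simpa [ha] using hnorm

theorem norm_shiftOp_planeWave_sub_le {a : ℂ} (ha : ‖a‖ = 1) (m : ℤ) (N : ℕ) :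
    ‖shiftOp (planeWave a m N) - a • planeWave a m N‖ ≤ 2 := by
  let f : ℕ → EllTwoZ := fun k => a ^ k • lp.single 2 (m + 1 - k) (1 : ℂ)
  have hf : ∀ k, ‖f k‖ = 1 := fun k => by
    rw [norm_smul, norm_pow, ha, one_pow, one_mul, lp.norm_single two_pos, norm_one]
  have htelescope : shiftOp (planeWave a m N) - a • planeWave a m N = f 0 - f N := by
    rw [← Finset.sum_range_sub', planeWave, map_sum, Finset.smul_sum, ← Finset.sum_sub_distrib]
    refine Finset.sum_congr rfl fun k _ => ?_
    have hk : m + 1 - ((k + 1 : ℕ) : ℤ) = m - k := by push_cast; ring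
    simp only [f, map_smul, shiftOp_single, hk, smul_smul, pow_succ', sub_add_eq_add_sub]
  calc ‖shiftOp (planeWave a m N) - a • planeWave a m N‖
      ≤ ‖f 0‖ + ‖f N‖ := htelescope ▸ norm_sub_le _ _
    _ = 2 := by rw [hf, hf, one_add_one_eq_two]

theorem add_inv_mem_spectrumPMap_jacobiOp (hd : Tendsto d atBot (𝓝 0)) {a : ℂ} (ha : ‖a‖ = 1) :
    a + a⁻¹ ∈ spectrumPMap (jacobiOp d) := by
  refine (mem_spectrumPMap_iff isSelfAdjoint_jacobiOp).mpr fun ε hε => ?_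
  obtain ⟨m, hm⟩ : ∃ m, ∀ n ≤ m, |d n| ≤ ε / 2 :=
    eventually_atBot.mp (hd.norm.eventually_le_const (by simpa using half_pos hε))
  obtain ⟨N, hN⟩ := exists_nat_gt ((4 / (ε / 2)) ^ 2)
  let x : (diagOp d).domain := ⟨planeWave a m N, planeWave_mem_diagOp_domain a m N⟩
  have hhop : ‖hopOp x - (a + a⁻¹) • (x : EllTwoZ)‖ ≤ 4 := by
    refine (norm_add_adjoint_sub_le norm_shiftOp_apply ha _).trans ?_
    linarith [norm_shiftOp_planeWave_sub_le ha m N]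
  have hdiag : ‖diagOp d x‖ ≤ ε / 2 * ‖(x : EllTwoZ)‖ :=
    norm_diagOp_le (fun n hn => hm n (le_of_planeWave_apply_ne_zero hn)) (half_pos hε).le
  have hlong : 4 < ε / 2 * ‖(x : EllTwoZ)‖ := by
    rw [← div_lt_iff₀' (half_pos hε)]
    exact lt_of_pow_lt_pow_left₀ 2 (norm_nonneg _) (hN.trans_eq (norm_planeWave_sq ha m N).symm)
  refine ⟨x, ?_⟩
  calc ‖jacobiOp d x - (a + a⁻¹) • (x : EllTwoZ)‖
      = ‖hopOp x - (a + a⁻¹) • (x : EllTwoZ) + diagOp d x‖ := by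
        rw [sub_add_eq_add_sub]; rfl
    _ ≤ ‖hopOp x - (a + a⁻¹) • (x : EllTwoZ)‖ + ‖diagOp d x‖ := norm_add_le _ _
    _ < ε * ‖(x : EllTwoZ)‖ := by linarith

theorem exists_norm_eq_one_add_inv_eq {t : ℝ} (ht : t ∈ Set.Icc (-2 : ℝ) 2) :
    ∃ a : ℂ, ‖a‖ = 1 ∧ a + a⁻¹ = t := by
  refine ⟨Complex.exp (Real.arccos (t / 2) * Complex.I), Complex.norm_exp_ofReal_mul_I _, ?_⟩
  rw [← Complex.exp_neg, ← neg_mul, ← Complex.two_cos, ← Complex.ofReal_cos,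
    Real.cos_arccos (by linarith [ht.1]) (by linarith [ht.2])]
  push_cast
  ring

theorem Icc_subset_spectrumPMap_jacobiOp (hd : Tendsto d atBot (𝓝 0)) :
    (fun x : ℝ => (x : ℂ)) '' Set.Icc (-2) 2 ⊆ spectrumPMap (jacobiOp d) := by
  rintro _ ⟨t, ht, rfl⟩
  obtain ⟨a, ha, hat⟩ := exists_norm_eq_one_add_inv_eq ht
  have h := add_inv_mem_spectrumPMap_jacobiOp hd ha
  rwa [hat] at h

theorem preperfect_ofReal_image_Icc {a b : ℝ} (hab : a < b) :
    Preperfect ((fun x : ℝ => (x : ℂ)) '' Set.Icc a b) :=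
  IsPreconnected.preperfect_of_nontrivial
    ((Set.nontrivial_of_lt (Set.left_mem_Icc.mpr hab.le) (Set.right_mem_Icc.mpr hab.le) hab).image
      Complex.ofReal_injective)
    (isPreconnected_Icc.image _ Complex.continuous_ofReal.continuousOn)

theorem eventually_cofinite_le_norm_sub (hbot : Tendsto d atBot (𝓝 0))
    (htop : Tendsto d atTop (𝓝 0) ∨ Tendsto d atTop (cobounded ℝ)) {z : ℂ} {c : ℝ}
    (hc : c < ‖z‖) : ∀ᶠ n in cofinite, c ≤ ‖(d n : ℂ) - z‖ := by
  have hzero : ∀ {l : Filter ℤ}, Tendsto d l (𝓝 0) → ∀ᶠ n in l, c ≤ ‖(d n : ℂ) - z‖ := by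
    intro l hl
    have h : Tendsto (fun n => ‖(d n : ℂ) - z‖) l (𝓝 ‖((0 : ℝ) : ℂ) - z‖) :=
      (((Complex.continuous_ofReal.tendsto 0).comp hl).sub_const z).norm
    exact h.eventually_const_le (by simpa using hc)
  rw [Int.cofinite_eq, eventually_sup]
  refine ⟨hzero hbot, htop.elim hzero fun hinf => ?_⟩
  filter_upwards [(tendsto_norm_atTop_iff_cobounded.mpr hinf).eventually_ge_atTop (c + ‖z‖)]
    with n hn
  rw [← Complex.norm_real] at hn
  linarith [norm_sub_norm_le (d n : ℂ) z]

theorem essSpectrumPMap_jacobiOp (hbot : Tendsto d atBot (𝓝 0))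
    (htop : Tendsto d atTop (𝓝 0) ∨ Tendsto d atTop (cobounded ℝ)) :
    essSpectrumPMap (jacobiOp d) = (fun x : ℝ => (x : ℂ)) '' Set.Icc (-2) 2 := by
  refine Set.Subset.antisymm (fun z hz => ?_) (subset_essSpectrumPMap_of_preperfect
    (preperfect_ofReal_image_Icc (by norm_num)) (Icc_subset_spectrumPMap_jacobiOp hbot))
  have hnot : ¬ BoundedBelowModCompact (jacobiOp d) z := fun h =>
    h.notMem_essSpectrumPMap isSelfAdjoint_jacobiOp hz
  have hreal : z.im = 0 := by
    by_contra him
    exact hnot (boundedBelowModCompact_of_im_ne_zero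
      (isFormalAdjoint_self_of_isSelfAdjoint isSelfAdjoint_jacobiOp) him)
  have hnorm : ‖z‖ ≤ 2 := by
    by_contra! hz2
    obtain ⟨c, hc2, hcz⟩ := exists_between hz2
    exact hnot (boundedBelowModCompact_vadd_diagOp (norm_hopOp_le.trans_lt hc2)
      (eventually_cofinite_le_norm_sub hbot htop hcz))
  exact ⟨z.re, abs_le.mp ((Complex.abs_re_le_norm z).trans hnorm), Complex.ext rfl hreal.symm⟩

end JacobiOperator

theorem tendsto_zpow_neg_atBot {q : ℝ} (hq0 : 0 < q) (hq1 : q < 1) :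
    Tendsto (fun n : ℤ => q ^ (-n)) atBot (𝓝 0) := by
  refine ((tendsto_rpow_atBot_of_base_gt_one q⁻¹ (one_lt_inv₀ hq0 |>.mpr hq1)).comp
    (tendsto_intCast_atBot_iff.mpr tendsto_id)).congr fun n => ?_
  simp only [Function.comp_apply, id, Real.rpow_intCast, inv_zpow']

theorem tendsto_zpow_neg_atTop {q : ℝ} (hq0 : 0 < q) (hq1 : q < 1) :
    Tendsto (fun n : ℤ => q ^ (-n)) atTop atTop := by
  refine ((tendsto_rpow_atTop_of_base_gt_one q⁻¹ (one_lt_inv₀ hq0 |>.mpr hq1)).comp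
    tendsto_intCast_atTop_atTop).congr fun n => ?_
  simp only [Function.comp_apply, Real.rpow_intCast, inv_zpow']

theorem mainTheorem6 (q : ℝ) (hq0 : 0 < q) (hq1 : q < 1) (α : ℝ) :
    essSpectrumPMap (opB α q) = (fun x : ℝ => (x : ℂ)) '' Set.Icc (-2) 2 := by
  rw [opB_eq_jacobiOp]
  refine essSpectrumPMap_jacobiOp ?_ ?_
  · simpa only [mul_zero] using (tendsto_zpow_neg_atBot hq0 hq1).const_mul α
  · rcases eq_or_ne α 0 with rfl | hα
    · simp only [zero_mul, tendsto_const_nhds, true_or]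
    · exact Or.inr ((tendsto_mul_left_cobounded hα).comp
        ((tendsto_zpow_neg_atTop hq0 hq1).mono_right IsOrderBornology.atTop_le_cobounded))
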